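/- A hypergraph consists of a finite vertex set $V$ and a set of subsets of $V$, called hyperedges (no repeated hyperedges). For an integer $t$, two subsets $A,B$ of a linearly ordered set form an $(AB)^{t/2}$-sequence if there are $t$ elements $x_1<x_2<\dots<x_t$ with $x_i\in A\setminus B$ for odd $i$ and $x_i\in B\setminus A$ for even $i$. A hypergraph is $(AB)^{t/2}$-free if its vertices can be linearly ordered so that no two hyperedges $A,B$ (taken in either order) form an $(AB)^{t/2}$-sequence. The dual of a hypergraph $H$ is obtained by reversing the roles of vertices and hyperedges: its vertices are the hyperedges of $H$, and for each vertex $v$ of $H$ it has the hyperedge $\{e : e \text{ is a hyperedge of } H,\ v\in e\}$. A hypergraph is dual-$(AB)^{t/2}$-free if its dual is $(AB)^{t/2}$-free. **Theorem.** (1) For every integer $t\ge 3$ there are constants $c_t,C_t>0$ such that for every integer $n\ge t$ the maximum number $M$ of hyperedges of an $(AB)^{t/2}$-free hypergraph on $n$ vertices satisfies $c_t\,n^{t-1}\le M\le C_t\,n^{t-1}$. (2) There are absolute constants $c,C>0$ such that for all integers $n\ge t\ge 3$ the maximum number $M$ of hyperedges of a dual-$(AB)^{t/2}$-free hypergraph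 on $n$ vertices satisfies $c\,t\,n^{2}\le M\le C\,t\,n^{2}$. -/

import Mathlib

open scoped Hypergraph

namespace Hypergraph

/-- Two subsets `A`, `B` of a linearly ordered type form an `(AB)^{t/2}`-sequence: there are `t`
elements `x 0 < x 1 < ⋯ < x (t-1)` that lie alternately in `A \ B` and `B \ A`, starting with
`A \ B`. -/
def FormABSeq {β : Type*} [LinearOrder β] (t : ℕ) (A B : Set β) : Prop :=
  ∃ x : Fin t → β, StrictMono x ∧
    ∀ i : Fin t, (Even (i : ℕ) → x i ∈ A \ B) ∧ (Odd (i : ℕ) → x i ∈ B \ A)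

/-- A hypergraph with an ordered vertex set is `(AB)^{t/2}`-free if no two hyperedges `A`, `B` (in
either order) form an `(AB)^{t/2}`-sequence. Hyperedges are subsets of `V(H)`; the preimage under
`Subtype.val` regards them as sets of elements of the ordered type `V(H)`. -/
def IsOrderedABFree {α : Type*} (H : Hypergraph α) [LinearOrder V(H)] (t : ℕ) : Prop :=
  ∀ A ∈ E(H), ∀ B ∈ E(H),
    ¬ FormABSeq t (Subtype.val ⁻¹' A : Set V(H)) (Subtype.val ⁻¹' B : Set V(H))

/-- A hypergraph with an unordered vertex set is `(AB)^{t/2}`-free if some linear ordering of its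
vertices makes it `(AB)^{t/2}`-free. -/
def IsABFree {α : Type*} (H : Hypergraph α) (t : ℕ) : Prop :=
  ∃ _ : LinearOrder V(H), H.IsOrderedABFree t

/-- The dual hypergraph: its vertices are the hyperedges of `H`, and each vertex `v` of `H` gives
the hyperedge consisting of all hyperedges of `H` that contain `v`. -/
def dual {α : Type*} (H : Hypergraph α) : Hypergraph (Set α) where
  vertexSet := E(H)
  edgeSet := {S | ∃ v ∈ V(H), S = {e | e ∈ E(H) ∧ v ∈ e}}
  subset_vertexSet_of_mem_edgeSet' := by
    rintro S ⟨v, -, rfl⟩ e he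
    exact he.1

/-- A hypergraph is dual-`(AB)^{t/2}`-free if its dual is `(AB)^{t/2}`-free. -/
def IsDualABFree {α : Type*} (H : Hypergraph α) (t : ℕ) : Prop :=
  H.dual.IsABFree t

/-- The possible numbers of hyperedges of an `(AB)^{t/2}`-free hypergraph on `n` vertices. -/
def abFreeSizes (t n : ℕ) : Set ℕ :=
  {m | ∃ H : Hypergraph (Fin n), V(H) = Set.univ ∧ H.IsABFree t ∧ E(H).ncard = m}

/-- The possible numbers of hyperedges of a dual-`(AB)^{t/2}`-free hypergraph on `n` vertices. -/
def dualABFreeSizes (t n : ℕ) : Set ℕ :=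
  {m | ∃ H : Hypergraph (Fin n), V(H) = Set.univ ∧ H.IsDualABFree t ∧ E(H).ncard = m}

end Hypergraph

/-!
For `(AB)^{t/2}`-free hypergraphs the upper bound is the Sauer-Shelah lemma: a shattered set of `t`
vertices has two traces that alternate along it (`exists_formABSeq_of_shatters`), so all shattered
sets have fewer than `t` elements (`IsABFree.ncard_edgeSet_le`). For the lower bound, take the sets
that avoid the far end of the order and have exactly `t - 1` prescribed boundary points. A member
of this family that alternates along `t` points has used all its boundaries before the last point,
hence does not contain it; but in an `(AB)^{t/2}`-sequence the last point lies in one of the two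
sets (`choose_mem_abFreeSizes`).

For the dual problem, consider distinct sets `e 0, e 1, …` of vertices such that no two vertices
alternate `t` times along them. Start with any linear order on the vertices, and at step `i` move
`e i` to the front, keeping the order inside `e i` and inside its complement (`stableOrder`). Then
`e i` is an initial segment of the next order. The first order has at most `n + 1` initial segments,
and the initial segments created by a step are charged injectively to the ordered pairs of vertices
flipped in that step (`exists_flip_of_mem_initialSegments`). Consecutive flips of the same pair have
opposite directions, so a pair is flipped fewer than `t` times (`count_flip_lt`), which bounds the
number of sets by `n + 1 + n ^ 2 * t` (`le_of_not_alternating`). For the lower bound, split the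
vertices into three chains of length about `n / 3` and take the unions of their initial segments of
lengths `a`, `b` and `p`, ordered lexicographically by `(p, a, b)`. For constant `p` no two vertices
alternate three times, and `p` itself ranges over about `t / 2` values, capped at `n / 3 + 1`
(`mul_mem_dualABFreeSizes`).
-/

namespace Hypergraph

open Finset

/-! ### Alternating sequences -/

lemma FormABSeq.mono {β : Type*} [LinearOrder β] {s t : ℕ} {A B : Set β} (hst : s ≤ t)
    (h : FormABSeq t A B) : FormABSeq s A B := by
  obtain ⟨x, hx, hAB⟩ := h
  exact ⟨x ∘ Fin.castLE hst, hx.comp (Fin.strictMono_castLE hst), fun i => hAB (Fin.castLE hst i)⟩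

/-! ### Shattering bounds the number of hyperedges from above -/

lemma exists_formABSeq_of_shatters {α : Type*} [DecidableEq α] {t : ℕ} {H : Hypergraph α}
    [LinearOrder V(H)] (hV : V(H) = Set.univ) {𝒜 : Finset (Finset α)}
    (h𝒜 : ∀ s ∈ 𝒜, (s : Set α) ∈ E(H)) {S : Finset α} (hS : 𝒜.Shatters S) (ht : #S = t) :
    ∃ A ∈ E(H), ∃ B ∈ E(H),
      FormABSeq t (Subtype.val ⁻¹' A : Set V(H)) (Subtype.val ⁻¹' B : Set V(H)) := by
  classical
  have hcard : #(S.subtype (· ∈ V(H))) = t := by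
    rw [Finset.card_subtype, Finset.filter_true_of_mem (by simp [hV]), ht]
  set x := (S.subtype (· ∈ V(H))).orderEmbOfFin hcard with hx
  have hxS : ∀ i, (x i : α) ∈ S := fun i =>
    Finset.mem_subtype.1 (Finset.orderEmbOfFin_mem _ hcard i)
  have hinj : ∀ i j, (x i : α) = x j → i = j := fun i j h => x.injective (Subtype.ext h)
  -- Shattering realises every trace on `S`; the two members used here have as traces the points
  -- of `S` in even, respectively odd, position.
  obtain ⟨A, hA, hAS⟩ := hS (t := S.filter fun s => ∃ i : Fin t, Even (i : ℕ) ∧ (x i : α) = s)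
    (Finset.filter_subset _ _)
  obtain ⟨B, hB, hBS⟩ := hS (t := S.filter fun s => ∃ i : Fin t, Odd (i : ℕ) ∧ (x i : α) = s)
    (Finset.filter_subset _ _)
  have memA : ∀ i, (x i : α) ∈ A ↔ Even (i : ℕ) := by
    intro i
    have := congrArg (fun s => (x i : α) ∈ s) hAS
    simp only [Finset.mem_inter, Finset.mem_filter, hxS, true_and, eq_iff_iff] at this
    rw [this]
    exact ⟨fun ⟨j, hj, hji⟩ => hinj _ _ hji ▸ hj, fun h => ⟨i, h, rfl⟩⟩
  have memB : ∀ i, (x i : α) ∈ B ↔ Odd (i : ℕ) := by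
    intro i
    have := congrArg (fun s => (x i : α) ∈ s) hBS
    simp only [Finset.mem_inter, Finset.mem_filter, hxS, true_and, eq_iff_iff] at this
    rw [this]
    exact ⟨fun ⟨j, hj, hji⟩ => hinj _ _ hji ▸ hj, fun h => ⟨i, h, rfl⟩⟩
  refine ⟨A, h𝒜 A hA, B, h𝒜 B hB, x, x.strictMono,
    fun i => ⟨fun hi => ⟨?_, ?_⟩, fun hi => ⟨?_, ?_⟩⟩⟩
  · simpa [memA] using hi
  · simpa [memB] using hi
  · simpa [memB] using hi
  · simpa [memA] using hi

theorem IsABFree.ncard_edgeSet_le {α : Type*} [Fintype α] [Nonempty α] {t : ℕ}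
    {H : Hypergraph α} (hV : V(H) = Set.univ) (hH : H.IsABFree t) :
    E(H).ncard ≤ t * Fintype.card α ^ (t - 1) := by
  classical
  obtain ⟨_, hfree⟩ := hH
  set 𝒜 : Finset (Finset (α)) := Finset.univ.filter fun s => (s : Set (α)) ∈ E(H) with h𝒜
  have hE : E(H) = (fun s : Finset (α) => (s : Set (α))) '' 𝒜 := by
    ext A
    constructor
    · intro hA
      exact ⟨A.toFinset, by simpa [h𝒜] using hA, by simp⟩
    · rintro ⟨s, hs, rfl⟩
      simpa [h𝒜] using hs
  have hsub : 𝒜.shatterer ⊆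
      (Finset.range t).biUnion fun k => Finset.powersetCard k Finset.univ := by
    intro S hS
    rw [Finset.mem_shatterer] at hS
    simp only [Finset.mem_biUnion, Finset.mem_range, Finset.mem_powersetCard_univ]
    refine ⟨#S, ?_, rfl⟩
    by_contra! hlt
    obtain ⟨A, hA, B, hB, hAB⟩ := exists_formABSeq_of_shatters hV
      (fun s hs => (Finset.mem_filter.1 hs).2) hS rfl
    exact hfree A hA B hB (hAB.mono hlt)
  calc E(H).ncard = #𝒜 := by
        rw [hE, Set.ncard_image_of_injective _ Finset.coe_injective, Set.ncard_coe_finset]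
    _ ≤ #𝒜.shatterer := 𝒜.card_le_card_shatterer
    _ ≤ ∑ k ∈ Finset.range t, (Fintype.card α).choose k := by
        refine (Finset.card_le_card hsub).trans (Finset.card_biUnion_le.trans_eq ?_)
        simp
    _ ≤ ∑ k ∈ Finset.range t, Fintype.card α ^ (t - 1) := by
        refine Finset.sum_le_sum fun k hk => (Nat.choose_le_pow _ k).trans ?_
        have := Finset.mem_range.1 hk
        exact Nat.pow_le_pow_right Fintype.card_pos (by omega)
    _ = t * Fintype.card α ^ (t - 1) := by simp

/-! ### Sets with prescribed boundary points -/

/-- The subset of a linear order that changes its membership exactly after the points of `S` and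
contains no point beyond the last of them. -/
def cutSet {n : ℕ} (S : Finset (Fin n)) : Set (Fin n) :=
  {v | Odd #{s ∈ S | v ≤ s}}

lemma cutSet_injective {n : ℕ} : Function.Injective (cutSet (n := n)) := by
  intro S T hST
  ext v
  induction v using WellFoundedGT.induction with
  | ind v ih =>
    have hlt : {s ∈ S | v < s} = {s ∈ T | v < s} := by
      ext u
      simp only [Finset.mem_filter]
      exact and_congr_left fun hu => ih u hu
    -- The parity of the number of points `≥ v` tells whether `v` itself is a boundary point.
    have key : ∀ R : Finset (Fin n),
        #{s ∈ R | v ≤ s} = #{s ∈ R | v < s} + if v ∈ R then 1 else 0 := by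
      intro R
      split_ifs with hv
      · have : {s ∈ R | v ≤ s} = insert v {s ∈ R | v < s} := by
          ext u; simp only [Finset.mem_filter, Finset.mem_insert, le_iff_lt_or_eq]; grind
        rw [this, Finset.card_insert_of_notMem (by simp)]
      · rw [add_zero]
        congr 1
        ext u; simp only [Finset.mem_filter, le_iff_lt_or_eq]; grind
    have hpar : Odd #{s ∈ S | v ≤ s} ↔ Odd #{s ∈ T | v ≤ s} := by
      have := congrArg (fun A => v ∈ A) hST
      simpa [cutSet] using this
    rw [key S, key T, hlt] at hpar
    by_cases h1 : v ∈ S <;> by_cases h2 : v ∈ T <;>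
      simp [h1, h2, Nat.odd_add_one, -Nat.not_odd_iff_even] at hpar ⊢

/-- If membership in `cutSet S` alternates along more than `#S` points, then every boundary point is
used up before the last of them, which therefore lies outside. -/
lemma notMem_cutSet_of_alternating {n k : ℕ} {S : Finset (Fin n)} (hS : #S ≤ k)
    {x : ℕ → Fin n} (hx : ∀ j < k, x j < x (j + 1))
    (halt : ∀ j < k, (x j ∈ cutSet S ↔ x (j + 1) ∉ cutSet S)) : x k ∉ cutSet S := by
  have key : ∀ j ≤ k, #{s ∈ S | x j ≤ s} + j ≤ #S := by
    intro j
    induction j with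
    | zero => intro _; simpa using Finset.card_filter_le _ _
    | succ j ih =>
      intro hj
      have h1 := ih (by omega)
      have h2 : #{s ∈ S | x (j + 1) ≤ s} ≤ #{s ∈ S | x j ≤ s} :=
        Finset.card_le_card fun s hs => by
          rw [Finset.mem_filter] at hs ⊢
          exact ⟨hs.1, (hx j hj).le.trans hs.2⟩
      have h3 : #{s ∈ S | x (j + 1) ≤ s} ≠ #{s ∈ S | x j ≤ s} := by
        intro h
        have := halt j hj
        simp only [cutSet, Set.mem_ofPred_eq, h] at this
        tauto
      omega
  have h0 : #{s ∈ S | x k ≤ s} = 0 := by have := key k le_rfl; omega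
  simp [cutSet, h0]

/-- The sets `cutSet S` with `#S = t - 1` form an `(AB)^{t/2}`-free hypergraph: the last point of an
`(AB)^{t/2}`-sequence would have to lie in neither of the two sets. -/
theorem choose_mem_abFreeSizes {t : ℕ} (ht : 1 ≤ t) (n : ℕ) :
    n.choose (t - 1) ∈ abFreeSizes t n := by
  classical
  refine ⟨⟨Set.univ, cutSet '' (Finset.powersetCard (t - 1) Finset.univ : Finset (Finset (Fin n))),
    fun _ _ => Set.subset_univ _⟩, rfl,
    ⟨(inferInstance : LinearOrder (Set.univ : Set (Fin n))), ?_⟩, ?_⟩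
  · rintro _ ⟨S, hS, rfl⟩ _ ⟨T, hT, rfl⟩ ⟨x, hx, hAB⟩
    have hS : #S = t - 1 := by simpa using hS
    have hT : #T = t - 1 := by simpa using hT
    let y : ℕ → Fin n := fun j => (x ⟨min j (t - 1), by omega⟩).1
    have hmin : ∀ j, j < t - 1 → min j (t - 1) = j ∧ min (j + 1) (t - 1) = j + 1 := by
      intro j hj; omega
    have hy : ∀ j < t - 1, y j < y (j + 1) := fun j hj =>
      hx (by simp only [Fin.mk_lt_mk, hmin j hj]; omega)
    have hyA : ∀ j ≤ t - 1, (y j ∈ cutSet S ↔ Even j) ∧ (y j ∈ cutSet T ↔ ¬ Even j) := by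
      intro j hj
      have h := hAB ⟨min j (t - 1), by omega⟩
      simp only [min_eq_left hj, Set.mem_sdiff, Set.mem_preimage] at h
      simp only [y, min_eq_left hj]
      rcases Nat.even_or_odd j with he | ho
      · have := h.1 he; tauto
      · have := h.2 ho
        have := Nat.not_even_iff_odd.2 ho
        tauto
    have h1 := notMem_cutSet_of_alternating hS.le hy fun j hj => by
      rw [(hyA j hj.le).1, (hyA (j + 1) hj).1, Nat.even_add_one, not_not]
    have h2 := notMem_cutSet_of_alternating hT.le hy fun j hj => by
      rw [(hyA j hj.le).2, (hyA (j + 1) hj).2, Nat.even_add_one, not_not]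
    rw [(hyA _ le_rfl).1] at h1
    rw [(hyA _ le_rfl).2] at h2
    exact h2 h1
  · rw [Set.ncard_image_of_injective _ cutSet_injective, Set.ncard_coe_finset]
    simp

lemma pow_le_choose_of_le {t n : ℕ} (ht : 1 ≤ t) (htn : t ≤ n) :
    1 / ((t : ℝ) ^ (t - 1) * (t - 1).factorial) * (n : ℝ) ^ (t - 1) ≤ n.choose (t - 1) := by
  refine le_trans ?_ (Nat.pow_le_choose (α := ℝ) (t - 1) n)
  have h : (n : ℝ) / t ≤ (n + 1 - (t - 1) : ℕ) := by
    obtain ⟨s, rfl⟩ := Nat.exists_eq_add_of_le ht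
    obtain ⟨d, rfl⟩ := Nat.exists_eq_add_of_le htn
    have : (1 + s + d + 1 - (1 + s - 1) : ℕ) = d + 2 := by omega
    rw [this, div_le_iff₀ (by positivity)]
    have : 1 + s + d ≤ (d + 2) * (1 + s) := by nlinarith
    exact_mod_cast this
  have h2 := pow_le_pow_left₀ (by positivity) h (t - 1)
  rw [div_pow] at h2
  calc _ = (n : ℝ) ^ (t - 1) / (t : ℝ) ^ (t - 1) / (t - 1).factorial := by field_simp
    _ ≤ _ := by gcongr

/-! ### Stable rearrangement and the dual upper bound -/

section StableOrder

variable {α : Type*}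

/-- The orders obtained from `r₀` by moving `e 0`, `e 1`, … to the front one after the other, each
time keeping the relative order inside the moved set and inside its complement. -/
def stableOrder (r₀ : α → α → Prop) (e : ℕ → Set α) : ℕ → α → α → Prop
  | 0 => r₀
  | i + 1 => fun u v =>
      (u ∈ e i ∧ v ∉ e i) ∨ (stableOrder r₀ e i u v ∧ (u ∈ e i ↔ v ∈ e i))

variable {r₀ : α → α → Prop} {e : ℕ → Set α}

lemma stableOrder_irrefl (h : ∀ u, ¬ r₀ u u) (i : ℕ) (u : α) : ¬ stableOrder r₀ e i u u := by
  induction i with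
  | zero => exact h u
  | succ i ih => simp only [stableOrder]; tauto

lemma stableOrder_trans (h : ∀ u v w, r₀ u v → r₀ v w → r₀ u w) (i : ℕ) {u v w : α}
    (huv : stableOrder r₀ e i u v) (hvw : stableOrder r₀ e i v w) : stableOrder r₀ e i u w := by
  induction i with
  | zero => exact h _ _ _ huv hvw
  | succ i ih => simp only [stableOrder] at *; tauto

lemma stableOrder_total (h : ∀ u v, u ≠ v → r₀ u v ∨ r₀ v u) (i : ℕ) {u v : α} (huv : u ≠ v) :
    stableOrder r₀ e i u v ∨ stableOrder r₀ e i v u := by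
  induction i with
  | zero => exact h _ _ huv
  | succ i ih => simp only [stableOrder]; tauto

/-- The initial segments of a relation, thought of as a strict linear order. -/
def initialSegments (r : α → α → Prop) : Set (Set α) :=
  {S | ∀ u ∈ S, ∀ v ∉ S, r u v}

lemma mem_initialSegments_stableOrder (i : ℕ) :
    e i ∈ initialSegments (stableOrder r₀ e (i + 1)) :=
  fun _ hu _ hv => Or.inl ⟨hu, hv⟩

lemma exists_eq_of_mem_initialSegments [Finite α] {r : α → α → Prop} (hirr : ∀ u, ¬ r u u)
    (htrans : ∀ u v w, r u v → r v w → r u w) (htot : ∀ u v, u ≠ v → r u v ∨ r v u)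
    {S : Set α} (hS : S ∈ initialSegments r) (hne : S ≠ Set.univ) :
    ∃ w ∉ S, S = {y | r y w} ∧ ∀ v ∉ S, v ≠ w → r w v := by
  have : IsTrans α r := ⟨htrans⟩
  have : Std.Irrefl r := ⟨hirr⟩
  obtain ⟨w, hw, hmin⟩ := (Finite.wellFounded_of_trans_of_irrefl r).has_min Sᶜ
    (Set.nonempty_compl.2 hne)
  refine ⟨w, hw, ?_, fun v hv hvw => (htot v w hvw).resolve_left (hmin v hv)⟩
  ext y
  exact ⟨fun hy => hS y hy w hw, fun hy => by_contra fun h => hmin y h hy⟩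

/-- A new initial segment is `{y | r y w}` for some `w` occurring in a flipped pair: the segment
is separated from its complement by a flipped pair `(u, v)`, and the least element `w` of the
complement lies between `u` and `v`, so it was flipped with one of them unless it is `v` itself. -/
lemma exists_flip_of_mem_initialSegments [Finite α] {r r' : α → α → Prop}
    (htrans : ∀ u v w, r u v → r v w → r u w) (htot : ∀ u v, u ≠ v → r u v ∨ r v u)
    (hirr' : ∀ u, ¬ r' u u) (htrans' : ∀ u v w, r' u v → r' v w → r' u w)
    (htot' : ∀ u v, u ≠ v → r' u v ∨ r' v u)
    {S : Set α} (hS' : S ∈ initialSegments r') (hS : S ∉ initialSegments r) :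
    ∃ w x, ¬ (r w x ↔ r' w x) ∧ S = {y | r' y w} := by
  have hne : S ≠ Set.univ := by
    rintro rfl
    exact hS fun u _ v hv => absurd (Set.mem_univ v) hv
  obtain ⟨w, hw, hSw, hmin⟩ := exists_eq_of_mem_initialSegments hirr' htrans' htot' hS' hne
  simp only [initialSegments, Set.mem_ofPred_eq, not_forall] at hS
  obtain ⟨u, hu, v, hv, huv⟩ := hS
  have huv_ne : u ≠ v := fun h => hv (h ▸ hu)
  have huw_ne : w ≠ u := fun h => hw (h ▸ hu)
  have hvu : r v u := (htot u v huv_ne).resolve_left huv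
  have huw' : r' u w := hS' u hu w hw
  have asymm' : ∀ a b, r' a b → ¬ r' b a := fun a b h1 h2 => hirr' a (htrans' _ _ _ h1 h2)
  by_cases hwu : r w u
  · exact ⟨w, u, fun h => asymm' _ _ huw' (h.1 hwu), hSw⟩
  · have huw : r u w := (htot w u huw_ne).resolve_left hwu
    have hvw_ne : v ≠ w := by rintro rfl; exact huv huw
    have hwv' : r' w v := hmin v hv hvw_ne
    exact ⟨w, v, fun h => huv (htrans _ _ _ huw (h.2 hwv')), hSw⟩

/-- A truth value that changes at least `t` times takes alternating values at its changes. -/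
lemma exists_alternating_of_le_count (p : ℕ → Prop) [DecidablePred fun i => ¬ (p i ↔ p (i + 1))]
    {m t : ℕ} (h : t ≤ Nat.count (fun i => ¬ (p i ↔ p (i + 1))) m) :
    ∃ x : Fin t → ℕ, StrictMono x ∧ (∀ j, x j < m) ∧ (∀ j, ¬ (p (x j) ↔ p (x j + 1))) ∧
      ∀ j, (p (x j) ↔ (p 0 ↔ Even (j : ℕ))) := by
  have hpar : ∀ i, p i ↔ (p 0 ↔ Even (Nat.count (fun i => ¬ (p i ↔ p (i + 1))) i)) := by
    intro i
    induction i with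
    | zero => simp
    | succ i ih =>
      rw [Nat.count_succ]
      split_ifs with hi
      · rw [add_zero]; tauto
      · rw [Nat.even_add_one]; tauto
  have hlt : ∀ j : Fin t, ∀ hf : (Set.ofPred fun i => ¬ (p i ↔ p (i + 1))).Finite,
      (j : ℕ) < #hf.toFinset := fun j hf => (j.2.trans_le h).trans_le (Nat.count_le_card hf m)
  refine ⟨fun j => Nat.nth _ (j : ℕ), fun a b hab => Nat.nth_lt_nth' hab (hlt b),
    fun j => Nat.nth_lt_of_lt_count (j.2.trans_le h), fun j => Nat.nth_mem _ (hlt j), fun j => ?_⟩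
  rw [hpar, Nat.count_nth (hlt j)]

/-- The flips of a fixed pair alternate in direction, and a flip at step `i` means that `e i`
separates the pair in that direction. -/
lemma count_flip_lt (w x : α)
    [DecidablePred fun i => ¬ (stableOrder r₀ e i w x ↔ stableOrder r₀ e (i + 1) w x)]
    {m t : ℕ}
    (h : ∀ u v, ¬ ∃ x : Fin t → ℕ, StrictMono x ∧ (∀ j, x j < m) ∧
      ∀ j : Fin t, (Even (j : ℕ) → u ∈ e (x j) ∧ v ∉ e (x j)) ∧
        (Odd (j : ℕ) → v ∈ e (x j) ∧ u ∉ e (x j))) :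
    Nat.count (fun i => ¬ (stableOrder r₀ e i w x ↔ stableOrder r₀ e (i + 1) w x)) m < t := by
  by_contra! hle
  classical
  obtain ⟨y, hy, hym, hflip, hpar⟩ := exists_alternating_of_le_count
    (fun i => stableOrder r₀ e i w x) hle
  have hflip' : ∀ j, if stableOrder r₀ e (y j) w x then x ∈ e (y j) ∧ w ∉ e (y j)
      else w ∈ e (y j) ∧ x ∉ e (y j) := by
    intro j
    have := hflip j
    simp only [stableOrder] at this
    split_ifs <;> tauto
  by_cases h0 : stableOrder r₀ e 0 w x
  · refine h x w ⟨y, hy, hym, fun j => ?_⟩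
    have h1 := hflip' j
    have h2 := hpar j
    rw [← Nat.not_even_iff_odd]
    split_ifs at h1 <;> tauto
  · refine h w x ⟨y, hy, hym, fun j => ?_⟩
    have h1 := hflip' j
    have h2 := hpar j
    rw [← Nat.not_even_iff_odd]
    split_ifs at h1 <;> tauto

/-- Every `e i` is an initial segment of some stable order, and apart from the initial segments of
`r₀` each of them is charged to a flip of an ordered pair. -/
theorem le_of_not_alternating [Fintype α] {m t : ℕ} (hinj : Set.InjOn e (Set.Iio m))
    (h : ∀ u v, ¬ ∃ x : Fin t → ℕ, StrictMono x ∧ (∀ j, x j < m) ∧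
      ∀ j : Fin t, (Even (j : ℕ) → u ∈ e (x j) ∧ v ∉ e (x j)) ∧
        (Odd (j : ℕ) → v ∈ e (x j) ∧ u ∉ e (x j))) :
    m ≤ Fintype.card α + 1 + Fintype.card α ^ 2 * t := by
  classical
  obtain ⟨r₀, hirr₀, htrans₀, htot₀⟩ : ∃ r₀ : α → α → Prop, (∀ u, ¬ r₀ u u) ∧
      (∀ u v w, r₀ u v → r₀ v w → r₀ u w) ∧ ∀ u v, u ≠ v → r₀ u v ∨ r₀ v u := by
    let f := Fintype.equivFin α
    exact ⟨fun u v => f u < f v, fun u => lt_irrefl _, fun u v w => lt_trans,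
      fun u v huv => lt_or_gt_of_ne (f.injective.ne huv)⟩
  set r := stableOrder r₀ e with hr
  have hirr := stableOrder_irrefl (e := e) hirr₀
  have htrans : ∀ i u v w, r i u v → r i v w → r i u w := fun i _ _ _ => stableOrder_trans htrans₀ i
  have htot : ∀ i u v, u ≠ v → r i u v ∨ r i v u := fun i _ _ => stableOrder_total htot₀ i
  let start : Finset (Set α) := insert Set.univ (Finset.univ.image fun w => {y | r 0 y w})
  let new : ℕ → Finset (Set α) := fun i =>
    (Finset.univ.filter fun p : α × α => ¬ (r i p.1 p.2 ↔ r (i + 1) p.1 p.2)).image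
      fun p => {y | r (i + 1) y p.1}
  have hseg : ∀ i ≤ m, ∀ S ∈ initialSegments (r i), S ∈ start ∪ (Finset.range m).biUnion new := by
    intro i
    induction i with
    | zero =>
      intro _ S hS
      refine Finset.mem_union_left _ (Finset.mem_insert.2 ?_)
      by_cases hne : S = Set.univ
      · exact Or.inl hne
      · obtain ⟨w, -, hw, -⟩ :=
          exists_eq_of_mem_initialSegments (hirr 0) (htrans 0) (htot 0) hS hne
        exact Or.inr (Finset.mem_image.2 ⟨w, Finset.mem_univ _, hw.symm⟩)
    | succ i ih =>
      intro hi S hS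
      by_cases hSi : S ∈ initialSegments (r i)
      · exact ih (by omega) S hSi
      · obtain ⟨w, x, hwx, hSw⟩ := exists_flip_of_mem_initialSegments (htrans i) (htot i)
          (hirr (i + 1)) (htrans (i + 1)) (htot (i + 1)) hS hSi
        refine Finset.mem_union_right _ (Finset.mem_biUnion.2 ⟨i, Finset.mem_range.2 hi, ?_⟩)
        exact Finset.mem_image.2 ⟨(w, x), by simpa using hwx, hSw.symm⟩
  have hstart : #start ≤ Fintype.card α + 1 :=
    (Finset.card_insert_le _ _).trans (Nat.add_le_add_right Finset.card_image_le 1)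
  have hnew : #((Finset.range m).biUnion new) ≤ Fintype.card α ^ 2 * t := by
    calc #((Finset.range m).biUnion new)
        ≤ ∑ i ∈ Finset.range m,
            #(Finset.univ.filter fun p : α × α => ¬ (r i p.1 p.2 ↔ r (i + 1) p.1 p.2)) :=
          Finset.card_biUnion_le.trans (Finset.sum_le_sum fun i _ => Finset.card_image_le)
      _ = ∑ p : α × α, Nat.count (fun i => ¬ (r i p.1 p.2 ↔ r (i + 1) p.1 p.2)) m := by
          simp only [Nat.count_eq_card_filter_range, Finset.card_filter]
          exact Finset.sum_comm
      _ ≤ ∑ _p : α × α, t := Finset.sum_le_sum fun p _ => (count_flip_lt p.1 p.2 h).le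
      _ = Fintype.card α ^ 2 * t := by simp [sq]
  calc m = #((Finset.range m).image e) := by
        rw [Finset.card_image_of_injOn (by simpa [Set.InjOn] using hinj), Finset.card_range]
    _ ≤ #(start ∪ (Finset.range m).biUnion new) := by
        refine Finset.card_le_card fun S hS => ?_
        obtain ⟨i, hi, rfl⟩ := Finset.mem_image.1 hS
        exact hseg (i + 1) (Finset.mem_range.1 hi) _ (mem_initialSegments_stableOrder i)
    _ ≤ _ := (Finset.card_union_le _ _).trans (Nat.add_le_add hstart hnew)

end StableOrder

/-- If distinct subsets of `α` are indexed by a finite linear order so that no two points alternate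
`t` times, then their number is at most quadratic in the number of points and linear in `t`. -/
theorem card_le_of_forall_not_formABSeq {α P : Type*} [Fintype α] [Fintype P] [ord : LinearOrder P]
    {t : ℕ} {f : P → Set α} (hf : Function.Injective f)
    (h : ∀ u v, ¬ FormABSeq t {p | u ∈ f p} {p | v ∈ f p}) :
    Fintype.card P ≤ Fintype.card α + 1 + Fintype.card α ^ 2 * t := by
  let g := Fintype.orderIsoFinOfCardEq P rfl
  let e : ℕ → Set α := fun i => if hi : i < Fintype.card P then f (g ⟨i, hi⟩) else ∅
  have he : ∀ i (hi : i < Fintype.card P), e i = f (g ⟨i, hi⟩) := fun i hi => dif_pos hi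
  refine le_of_not_alternating (e := e) ?_ ?_
  · intro i hi j hj hij
    rw [he i hi, he j hj] at hij
    exact congrArg Fin.val (g.injective (hf hij))
  · rintro u v ⟨x, hx, hxm, hAB⟩
    refine h u v ⟨fun j => g ⟨x j, hxm j⟩, fun a b hab => g.strictMono (hx hab), fun j => ?_⟩
    have h := hAB j
    rw [he _ (hxm j)] at h
    exact h

theorem IsDualABFree.ncard_edgeSet_le {α : Type*} [Fintype α] {t : ℕ} {H : Hypergraph α}
    (hV : V(H) = Set.univ) (hH : H.IsDualABFree t) :
    E(H).ncard ≤ Fintype.card α + 1 + Fintype.card α ^ 2 * t := by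
  classical
  obtain ⟨ord, hfree⟩ := hH
  have : Fintype V(H.dual) := Fintype.ofFinite _
  have hcard : Fintype.card V(H.dual) = E(H).ncard := (Nat.card_eq_fintype_card).symm
  rw [← hcard]
  refine card_le_of_forall_not_formABSeq (P := V(H.dual)) (ord := ord) (f := Subtype.val)
    Subtype.val_injective ?_
  rintro u v ⟨x, hx, hAB⟩
  refine hfree {S | S ∈ E(H) ∧ u ∈ S} ⟨u, hV ▸ Set.mem_univ u, rfl⟩
    {S | S ∈ E(H) ∧ v ∈ S} ⟨v, hV ▸ Set.mem_univ v, rfl⟩ ⟨x, hx, fun j => ?_⟩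
  have hE : (x j).1 ∈ E(H) := (x j).2
  have h := hAB j
  simp only [Set.mem_sdiff, Set.mem_ofPred_eq] at h
  simp only [Set.mem_sdiff, Set.mem_preimage, Set.mem_ofPred_eq, hE, true_and]
  exact h

/-! ### A product of chains -/

/-- A finite linearly ordered set of distinct subsets of `Fin n` on which no two points alternate
`t` times is the edge set of a dual-`(AB)^{t/2}`-free hypergraph. -/
theorem card_mem_dualABFreeSizes {P : Type*} [Fintype P] [LinearOrder P] {t n : ℕ}
    {f : P → Set (Fin n)} (hf : Function.Injective f)
    (h : ∀ u v, ¬ FormABSeq t {p | u ∈ f p} {p | v ∈ f p}) :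
    Fintype.card P ∈ dualABFreeSizes t n := by
  refine ⟨⟨Set.univ, Set.range f, fun _ _ => Set.subset_univ _⟩, rfl, ?_, ?_⟩
  · let g := Equiv.ofInjective f hf
    refine ⟨LinearOrder.lift' g.symm g.symm.injective, ?_⟩
    rintro _ ⟨u, -, rfl⟩ _ ⟨v, -, rfl⟩ ⟨x, hx, hAB⟩
    refine h u v ⟨fun j => g.symm (x j), fun a b hab => hx hab, fun j => ?_⟩
    have hfg : f (g.symm (x j)) = (x j).1 := congrArg Subtype.val (g.apply_symm_apply (x j))
    have hE : (x j).1 ∈ Set.range f := (x j).2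
    have h1 := hAB j
    simp only [Set.mem_sdiff, Set.mem_preimage, Set.mem_ofPred_eq] at h1
    simp only [Set.mem_sdiff, Set.mem_ofPred_eq, hfg]
    tauto
  · rw [← Set.image_univ, Set.ncard_image_of_injective _ hf, Set.ncard_univ,
      Nat.card_eq_fintype_card]

/-- The union of an initial segment of length `a` of the vertices `0, …, h - 1`, one of length `b`
of `h, …, 2h - 1` and one of length `p` of `2h, …, 3h - 1`; meant for `a, b, p ≤ h` and `3h ≤ n`. -/
def gridSet (n h p a b : ℕ) : Set (Fin n) :=
  {v | (v : ℕ) < a ∨ (h ≤ (v : ℕ) ∧ (v : ℕ) < h + b) ∨ (2 * h ≤ (v : ℕ) ∧ (v : ℕ) < 2 * h + p)}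

lemma gridSet_inj {n h p a b p' a' b' : ℕ} (hn : 3 * h ≤ n) (hp : p ≤ h) (ha : a ≤ h) (hb : b ≤ h)
    (hp' : p' ≤ h) (ha' : a' ≤ h) (hb' : b' ≤ h)
    (heq : gridSet n h p a b = gridSet n h p' a' b') : p = p' ∧ a = a' ∧ b = b' := by
  have key : ∀ v < n, (v < a ∨ (h ≤ v ∧ v < h + b) ∨ (2 * h ≤ v ∧ v < 2 * h + p)) ↔
      (v < a' ∨ (h ≤ v ∧ v < h + b') ∨ (2 * h ≤ v ∧ v < 2 * h + p')) := by
    intro v hv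
    have := congrArg (fun S => (⟨v, hv⟩ : Fin n) ∈ S) heq
    simpa [gridSet] using this
  refine ⟨?_, ?_, ?_⟩
  · by_contra hne
    have := key (2 * h + min p p') (by omega)
    omega
  · by_contra hne
    have := key (min a a') (by omega)
    omega
  · by_contra hne
    have := key (h + min b b') (by omega)
    omega

/-- While `p` is fixed and `a` does not decrease, two vertices do not alternate three times:
vertices of the same group have nested traces, those of the third group have constant ones, and a
vertex of the first group never leaves. -/
lemma gridSet_not_alternating {n h p a₀ a₁ a₂ b₀ b₁ b₂ : ℕ} (hb₁ : b₁ ≤ h)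
    (h₀₁ : a₀ ≤ a₁) (h₁₂ : a₁ ≤ a₂)
    {u v : Fin n} (hu₀ : u ∈ gridSet n h p a₀ b₀) (hv₀ : v ∉ gridSet n h p a₀ b₀)
    (hv₁ : v ∈ gridSet n h p a₁ b₁) (hu₁ : u ∉ gridSet n h p a₁ b₁)
    (hv₂ : v ∉ gridSet n h p a₂ b₂) : False := by
  simp only [gridSet, Set.mem_ofPred_eq] at *
  omega

/-- The sets `gridSet n h p a b` with `p < K` and `a, b ≤ h`, in the lexicographic order of
`(p, a, b)`: each value of `p` contributes at most two terms to an alternating sequence. -/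
theorem mul_mem_dualABFreeSizes {t n h K : ℕ} (hn : 3 * h ≤ n) (hK : K ≤ h + 1) (hKt : 2 * K < t) :
    K * ((h + 1) * (h + 1)) ∈ dualABFreeSizes t n := by
  let P := Fin K ×ₗ (Fin (h + 1) ×ₗ Fin (h + 1))
  let cp : P → ℕ := fun q => ((ofLex q).1 : ℕ)
  let ca : P → ℕ := fun q => ((ofLex (ofLex q).2).1 : ℕ)
  let cb : P → ℕ := fun q => ((ofLex (ofLex q).2).2 : ℕ)
  have hcp : ∀ q, cp q < K := fun q => (ofLex q).1.2
  have hca : ∀ q, ca q ≤ h := fun q => Nat.lt_succ_iff.1 (ofLex (ofLex q).2).1.2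
  have hcb : ∀ q, cb q ≤ h := fun q => Nat.lt_succ_iff.1 (ofLex (ofLex q).2).2.2
  have hlt : ∀ q q' : P, q < q' → cp q < cp q' ∨ cp q = cp q' ∧ ca q ≤ ca q' := by
    intro q q' hq
    rcases Prod.Lex.lt_iff.1 hq with h1 | ⟨h1, h2⟩
    · exact Or.inl h1
    · refine Or.inr ⟨congrArg Fin.val h1, ?_⟩
      rcases Prod.Lex.lt_iff.1 h2 with h3 | ⟨h3, -⟩
      · exact le_of_lt h3
      · exact le_of_eq (congrArg Fin.val h3)
  let f : P → Set (Fin n) := fun q => gridSet n h (cp q) (ca q) (cb q)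
  have hf : Function.Injective f := by
    intro q q' hq
    have := hcp q
    have := hcp q'
    obtain ⟨h1, h2, h3⟩ := gridSet_inj hn (by omega) (hca q) (hcb q) (by omega) (hca q') (hcb q') hq
    exact Prod.ext (Fin.ext h1) (Prod.ext (Fin.ext h2) (Fin.ext h3))
  have hcard : Fintype.card P = K * ((h + 1) * (h + 1)) := by
    simp [P, Fintype.card_lex]
  rw [← hcard]
  refine card_mem_dualABFreeSizes hf ?_
  rintro u v ⟨x, hx, hAB⟩
  -- Two steps of an alternating sequence increase `p`, which takes only `K` values.
  have hstep : ∀ j (hj : j + 2 < t), cp (x ⟨j, by omega⟩) < cp (x ⟨j + 2, hj⟩) := by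
    intro j hj
    have h01 := hlt (x ⟨j, by omega⟩) (x ⟨j + 1, by omega⟩) (hx (by simp))
    have h12 := hlt (x ⟨j + 1, by omega⟩) (x ⟨j + 2, hj⟩) (hx (by simp))
    by_contra hle
    have e01 : cp (x ⟨j + 1, by omega⟩) = cp (x ⟨j, by omega⟩) := by omega
    have e02 : cp (x ⟨j + 2, hj⟩) = cp (x ⟨j, by omega⟩) := by omega
    have m0 := hAB ⟨j, by omega⟩
    have m1 := hAB ⟨j + 1, by omega⟩
    have m2 := hAB ⟨j + 2, hj⟩
    simp only [Set.mem_sdiff, Set.mem_ofPred_eq, f, e01, e02] at m0 m1 m2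
    have a01 : ca (x ⟨j, by omega⟩) ≤ ca (x ⟨j + 1, by omega⟩) := by omega
    have a12 : ca (x ⟨j + 1, by omega⟩) ≤ ca (x ⟨j + 2, hj⟩) := by omega
    rcases Nat.even_or_odd j with he | ho
    · have m0 := m0.1 he
      have m1 := m1.2 he.add_one
      have m2 := m2.1 (he.add (by decide))
      exact gridSet_not_alternating (hcb _) a01 a12
        m0.1 m0.2 m1.1 m1.2 m2.2
    · have m0 := m0.2 ho
      have m1 := m1.1 ho.add_one
      have m2 := m2.2 (ho.add_even (by decide))
      exact gridSet_not_alternating (hcb _) a01 a12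
        m0.1 m0.2 m1.1 m1.2 m2.2
  have hgrow : ∀ i (hi : 2 * i < t), i ≤ cp (x ⟨2 * i, hi⟩) := by
    intro i
    induction i with
    | zero => intro _; exact Nat.zero_le _
    | succ i ih =>
      intro hi
      have h1 := ih (by omega)
      have h2 := hstep (2 * i) (by omega)
      exact h1.trans_lt h2
  exact absurd (hgrow K hKt) (not_le.2 (hcp _))

/-! ### Extremal numbers -/

lemma exists_isGreatest_of_mem_of_le {s : Set ℕ} {m b : ℕ} (hm : m ∈ s) (hb : ∀ k ∈ s, k ≤ b) :
    ∃ M, IsGreatest s M ∧ m ≤ M ∧ M ≤ b := by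
  have hbdd : BddAbove s := ⟨b, hb⟩
  have hM := Nat.sSup_mem ⟨m, hm⟩ hbdd
  exact ⟨sSup s, ⟨hM, fun k hk => le_csSup hbdd hk⟩, le_csSup hbdd hm, hb _ hM⟩

end Hypergraph

theorem mainTheorem5 :
    (∀ t : ℕ, 3 ≤ t → ∃ c C : ℝ, 0 < c ∧ 0 < C ∧ ∀ n : ℕ, t ≤ n →
      ∃ M : ℕ, IsGreatest (Hypergraph.abFreeSizes t n) M ∧
        c * (n : ℝ) ^ (t - 1) ≤ (M : ℝ) ∧ (M : ℝ) ≤ C * (n : ℝ) ^ (t - 1)) ∧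
    (∃ c C : ℝ, 0 < c ∧ 0 < C ∧ ∀ t n : ℕ, 3 ≤ t → t ≤ n →
      ∃ M : ℕ, IsGreatest (Hypergraph.dualABFreeSizes t n) M ∧
        c * ((t : ℝ) * (n : ℝ) ^ 2) ≤ (M : ℝ) ∧ (M : ℝ) ≤ C * ((t : ℝ) * (n : ℝ) ^ 2)) := by
  constructor
  · intro t ht
    have ht0 : (0 : ℝ) < t := by exact_mod_cast (by omega : 0 < t)
    refine ⟨1 / ((t : ℝ) ^ (t - 1) * (t - 1).factorial), t, by positivity, ht0, fun n htn => ?_⟩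
    have : Nonempty (Fin n) := ⟨⟨0, by omega⟩⟩
    obtain ⟨M, hM, hl, hu⟩ := Hypergraph.exists_isGreatest_of_mem_of_le
      (Hypergraph.choose_mem_abFreeSizes (by omega : 1 ≤ t) n) (b := t * n ^ (t - 1)) (by
        rintro _ ⟨H, hV, hH, rfl⟩
        simpa using hH.ncard_edgeSet_le hV)
    refine ⟨M, hM, ?_, by exact_mod_cast hu⟩
    exact (Hypergraph.pow_le_choose_of_le (by omega) htn).trans (by exact_mod_cast hl)
  · refine ⟨1 / 36, 2, by norm_num, by norm_num, fun t n ht htn => ?_⟩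
    -- Blocks of `n / 3` vertices; `2 * K < t` is what freeness of the product of chains requires.
    obtain ⟨M, hM, hl, hu⟩ := Hypergraph.exists_isGreatest_of_mem_of_le
      (Hypergraph.mul_mem_dualABFreeSizes (t := t) (n := n) (h := n / 3)
        (K := min ((t - 1) / 2) (n / 3 + 1)) (by omega) (by omega) (by omega))
      (b := n + 1 + n ^ 2 * t) (by
        rintro _ ⟨H, hV, hH, rfl⟩
        simpa using hH.ncard_edgeSet_le hV)
    refine ⟨M, hM, ?_, ?_⟩
    · have h1 : t ≤ 4 * min ((t - 1) / 2) (n / 3 + 1) := by omega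
      have h2 : n ≤ 3 * (n / 3 + 1) := by omega
      have h3 : t * n ^ 2 ≤ 36 * M := by
        calc t * n ^ 2 ≤ (4 * min ((t - 1) / 2) (n / 3 + 1)) * (3 * (n / 3 + 1)) ^ 2 :=
              Nat.mul_le_mul h1 (Nat.pow_le_pow_left h2 2)
          _ = 36 * (min ((t - 1) / 2) (n / 3 + 1) * ((n / 3 + 1) * (n / 3 + 1))) := by ring
          _ ≤ 36 * M := Nat.mul_le_mul_left _ hl
      have h4 : (t : ℝ) * (n : ℝ) ^ 2 ≤ 36 * M := by exact_mod_cast h3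
      linarith
    · have h1 : n + 1 ≤ t * n ^ 2 := by nlinarith [Nat.mul_le_mul (ht : 3 ≤ t) (le_refl (n ^ 2))]
      have h2 : M ≤ 2 * (t * n ^ 2) := by linarith [mul_comm t (n ^ 2)]
      exact_mod_cast h2
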